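/- Let $\gamma$ be a circle equipped with a smooth Riemannian metric (of any length, for instance $2\pi$), and let $s$ be its natural (arc length) parameter. Use the unit field $\partial/\partial s$ to write the points of $T\gamma$ as pairs $(s,y)$, $y\in\mathbb R$, and those of the unit ball bundle $T_{<1}\gamma$ as pairs $(s,w)$, $|w|<1$. Let $\omega=d\alpha=dw\wedge ds$ be the standard symplectic form on $T_{<1}\gamma$, where $\alpha=w\,ds$ is the Liouville form, and equip $C^\infty(T\gamma)$ with the Poisson bracket of the pushforward $Y_*\omega$ under the diffeomorphism $Y:T_{<1}\gamma\to T\gamma$, $Y(s,w)=\bigl(s,\,w/\sqrt{1-w^2}\bigr)$; in the coordinates $(s,w)$ this bracket is $\{F,G\}=\partial_wF\,\partial_sG-\partial_sF\,\partial_wG$. For an integer $d\ge 0$ and $h\in C^\infty(\gamma)$ put $$H_{d,h}(s,y)=\frac{h(s)\,y^d}{\sqrt{1+y^2}},\qquad \Lambda_d=\{H_{d,h}: h\in C^\infty(\gamma)\},\qquad \Lambda_{d,0}=\Bigl\{H_{d,h}: h\in C^\infty(\gamma),\ \int_\gamma h\,ds=0\Bigr\}.$$ Let $\mathfrak H$ be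 the real Lie algebra generated, under the Poisson bracket, by the functions $H_{0,f}$, $f\in C^\infty(\gamma)$. Then $$\mathfrak H=\Lambda_1\oplus\Bigl(\bigoplus_{d\ge 0\text{ even}}\Lambda_d\Bigr)\oplus\Bigl(\bigoplus_{d\ge 3\text{ odd}}\Lambda_{d,0}\Bigr)\oplus\Psi$$ (an internal direct sum of vector subspaces), where $\Psi$ is the space of the functions $P(y)/\sqrt{1+y^2}$ such that $P(y)=\sum_{j=1}^k a_jy^{2j+1}$ is a real polynomial for which $\widetilde P(x)=\sum_{j=1}^k a_jx^j$ satisfies $\widetilde P'(-1)=0$. -/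

import Mathlib

open scoped ContDiff

noncomputable section

namespace ThinFilm

/-- A circle with a Riemannian metric.  The circle is `ℝ / 2πℤ` with a coordinate `t` (not assumed
to be arc length), functions on it being `2π`-periodic functions on `ℝ`; the metric is
`g(t) dt²` with `g` smooth and positive. -/
structure RiemannianCircle where
  /-- the coefficient of the metric -/
  g : ℝ → ℝ
  smooth : ContDiff ℝ ∞ g
  periodic : Function.Periodic g (2 * Real.pi)
  pos : ∀ t, 0 < g t

/-- The density of the length element: `ds = √(g(t)) dt`. -/
def RiemannianCircle.speed (γ : RiemannianCircle) (t : ℝ) : ℝ := √(γ.g t)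

/-- `C^∞(γ)`: the smooth functions on the circle. -/
def circleFun : Subalgebra ℝ (ℝ → ℝ) where
  carrier := {f | ContDiff ℝ ∞ f ∧ Function.Periodic f (2 * Real.pi)}
  mul_mem' hf hg := ⟨hf.1.mul hg.1, hf.2.mul hg.2⟩
  add_mem' hf hg := ⟨hf.1.add hg.1, hf.2.add hg.2⟩
  algebraMap_mem' _ := ⟨contDiff_const, fun _ => rfl⟩

/-- The integral `∫_γ h ds` over the circle with respect to the length element. -/
def arcIntegral (γ : RiemannianCircle) (h : ℝ → ℝ) : ℝ :=
  ∫ t in (0 : ℝ)..(2 * Real.pi), h t * γ.speed t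

/-! The unit vector field `∂/∂s` trivializes the tangent bundle: a point of `Tγ` is a pair `(t, y)`,
standing for the vector `y ∂/∂s` at `t`, and the unit ball bundle `T_{<1}γ` consists of the pairs
`(t, w)` with `|w| < 1`. -/

/-- `C^∞(Tγ)`: the smooth functions of `(t, y)`, periodic in `t`. -/
def tangentFun : Subalgebra ℝ (ℝ × ℝ → ℝ) where
  carrier := {F | ContDiff ℝ ∞ F ∧ ∀ t y, F (t + 2 * Real.pi, y) = F (t, y)}
  mul_mem' hf hg := ⟨hf.1.mul hg.1, fun t y => by simp [hf.2 t y, hg.2 t y]⟩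
  add_mem' hf hg := ⟨hf.1.add hg.1, fun t y => by simp [hf.2 t y, hg.2 t y]⟩
  algebraMap_mem' _ := ⟨contDiff_const, fun _ _ => rfl⟩

/-- The Liouville form `α = ⟨w, dπ(·)⟩ = w ds` at the point `(t, w)`. -/
def liouville (γ : RiemannianCircle) (p : ℝ × ℝ) : ℝ × ℝ →L[ℝ] ℝ :=
  (p.2 * γ.speed p.1) • ContinuousLinearMap.fst ℝ ℝ ℝ

/-- The standard symplectic form `ω = dα` on `T_{<1}γ`, in the coordinates `(t, w)`. -/
def symplecticForm (γ : RiemannianCircle) (p U V : ℝ × ℝ) : ℝ :=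
  fderiv ℝ (liouville γ) p U V - fderiv ℝ (liouville γ) p V U

/-- The inverse `(t, y) ↦ (t, w)`, `w = y / √(1 + y²)`, of the renormalization
`Y : T_{<1}γ → Tγ`, `(t, w) ↦ (t, w / √(1 - w²))`. -/
def renormInv (p : ℝ × ℝ) : ℝ × ℝ := (p.1, p.2 / √(1 + p.2 ^ 2))

/-- The pushforward symplectic form `Y_* ω` on `Tγ`, in the coordinates `(t, y)`. -/
def pushedForm (γ : RiemannianCircle) (p U V : ℝ × ℝ) : ℝ :=
  symplecticForm γ (renormInv p) (fderiv ℝ renormInv p U) (fderiv ℝ renormInv p V)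

/-- The partial derivative in `t`. -/
def dt (F : ℝ × ℝ → ℝ) (p : ℝ × ℝ) : ℝ := fderiv ℝ F p (1, 0)

/-- The partial derivative in `y`. -/
def dy (F : ℝ × ℝ → ℝ) (p : ℝ × ℝ) : ℝ := fderiv ℝ F p (0, 1)

/-- The Poisson bracket on `Tγ` of the symplectic form `Y_* ω = Ω dy ∧ dt`, where
`Ω = (Y_* ω)(∂/∂y, ∂/∂t)`.  In the coordinates `(s, w)` it reads `F_w G_s - F_s G_w`. -/
def poisson (γ : RiemannianCircle) (F G : ℝ × ℝ → ℝ) (p : ℝ × ℝ) : ℝ :=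
  (dy F p * dt G p - dt F p * dy G p) / pushedForm γ p (0, 1) (1, 0)

/-! ### The Poisson bracket makes `C^∞(Tγ)` a Lie algebra -/

lemma speed_smooth (γ : RiemannianCircle) : ContDiff ℝ ∞ γ.speed :=
  γ.smooth.sqrt fun t => (γ.pos t).ne'

lemma speed_pos (γ : RiemannianCircle) (t : ℝ) : 0 < γ.speed t := Real.sqrt_pos.2 (γ.pos t)

lemma one_add_sq_pos (y : ℝ) : 0 < 1 + y ^ 2 := by positivity

lemma hasFDerivAt_liouville (γ : RiemannianCircle) (p : ℝ × ℝ) :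
    HasFDerivAt (liouville γ)
      ((p.2 • (deriv γ.speed p.1 • ContinuousLinearMap.fst ℝ ℝ ℝ)
        + γ.speed p.1 • ContinuousLinearMap.snd ℝ ℝ ℝ).smulRight
          (ContinuousLinearMap.fst ℝ ℝ ℝ)) p := by
  have h1 : HasFDerivAt (fun q : ℝ × ℝ => γ.speed q.1)
      (deriv γ.speed p.1 • ContinuousLinearMap.fst ℝ ℝ ℝ) p :=
    (((speed_smooth γ).differentiable (by simp)) p.1).hasDerivAt.comp_hasFDerivAt p hasFDerivAt_fst
  have h2 : HasFDerivAt (fun q : ℝ × ℝ => q.2 * γ.speed q.1)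
      (p.2 • (deriv γ.speed p.1 • ContinuousLinearMap.fst ℝ ℝ ℝ)
        + γ.speed p.1 • ContinuousLinearMap.snd ℝ ℝ ℝ) p := hasFDerivAt_snd.mul h1
  exact h2.smul_const (ContinuousLinearMap.fst ℝ ℝ ℝ)

lemma symplecticForm_apply (γ : RiemannianCircle) (p U V : ℝ × ℝ) :
    symplecticForm γ p U V = γ.speed p.1 * (U.2 * V.1 - U.1 * V.2) := by
  simp only [symplecticForm, (hasFDerivAt_liouville γ p).fderiv]
  simp
  ring

lemma hasDerivAt_renorm (y : ℝ) :
    HasDerivAt (fun y : ℝ => y / √(1 + y ^ 2)) ((√(1 + y ^ 2) ^ 3)⁻¹) y := by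
  have hp := one_add_sq_pos y
  have h0 : HasDerivAt (fun y : ℝ => 1 + y ^ 2) (2 * y) y := by
    simpa using (hasDerivAt_pow 2 y).const_add 1
  have hs : √(1 + y ^ 2) ≠ 0 := (Real.sqrt_pos.2 hp).ne'
  have h2 : √(1 + y ^ 2) ^ 2 = 1 + y ^ 2 := Real.sq_sqrt hp.le
  have h : HasDerivAt (fun y : ℝ => y / √(1 + y ^ 2)) _ y :=
    (hasDerivAt_id' y).fun_div (h0.sqrt hp.ne') hs
  refine h.congr_deriv ?_
  field_simp
  rw [h2]; ring

lemma fderiv_renormInv (p U : ℝ × ℝ) :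
    fderiv ℝ renormInv p U = (U.1, (√(1 + p.2 ^ 2) ^ 3)⁻¹ * U.2) := by
  have h1 : HasFDerivAt (fun q : ℝ × ℝ => q.2) (ContinuousLinearMap.snd ℝ ℝ ℝ) p :=
    hasFDerivAt_snd
  have h : HasFDerivAt renormInv _ p :=
    hasFDerivAt_fst.prodMk ((hasDerivAt_renorm p.2).comp_hasFDerivAt p h1)
  rw [h.fderiv]; simp

lemma pushedForm_coeff (γ : RiemannianCircle) (p : ℝ × ℝ) :
    pushedForm γ p (0, 1) (1, 0) = γ.speed p.1 * (√(1 + p.2 ^ 2) ^ 3)⁻¹ := by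
  simp [pushedForm, symplecticForm_apply, fderiv_renormInv, renormInv]

lemma fderiv_periodic {F : ℝ × ℝ → ℝ} (hF : F ∈ tangentFun) (t y : ℝ) :
    fderiv ℝ F (t + 2 * Real.pi, y) = fderiv ℝ F (t, y) := by
  have h : (fun q : ℝ × ℝ => F (q + (2 * Real.pi, 0))) = F := by
    funext q; simpa [Prod.add_def] using hF.2 q.1 q.2
  have h2 := fderiv_comp_add_right (𝕜 := ℝ) (f := F) (x := (t, y)) (2 * Real.pi, 0)
  rw [h] at h2
  simpa using h2.symm

lemma fderiv_apply_mem {F : ℝ × ℝ → ℝ} (hF : F ∈ tangentFun) (U : ℝ × ℝ) :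
    (fun p => fderiv ℝ F p U) ∈ tangentFun :=
  ⟨(hF.1.fderiv_right (m := ∞) (by simp)).clm_apply contDiff_const,
    fun t y => by simp only [fderiv_periodic hF]⟩

/-- The derivative in a fixed direction, on `C^∞(Tγ)`. -/
def dirDeriv (U : ℝ × ℝ) (F : tangentFun) : tangentFun := ⟨_, fderiv_apply_mem F.2 U⟩

/-- The coefficient `1 / Ω` of the Poisson bracket, as an element of `C^∞(Tγ)`. -/
def poissonCoeff (γ : RiemannianCircle) : tangentFun :=
  ⟨fun p => (pushedForm γ p (0, 1) (1, 0))⁻¹, by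
    simp only [pushedForm_coeff]
    refine ⟨?_, fun t y => ?_⟩
    · refine ContDiff.inv ?_ fun p => ?_
      · refine ((speed_smooth γ).comp contDiff_fst).mul (ContDiff.inv ?_ fun p => ?_)
        · exact (ContDiff.sqrt (f := fun p : ℝ × ℝ => 1 + p.2 ^ 2) (by fun_prop)
            fun p => (one_add_sq_pos p.2).ne').pow 3
        · exact (pow_pos (Real.sqrt_pos.2 (one_add_sq_pos p.2)) 3).ne'
      · exact (mul_pos (speed_pos γ p.1)
          (inv_pos.2 (pow_pos (Real.sqrt_pos.2 (one_add_sq_pos p.2)) 3))).ne'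
    · simp only [RiemannianCircle.speed, γ.periodic t]⟩

lemma diffAt (F : tangentFun) (p : ℝ × ℝ) : DifferentiableAt ℝ (F : ℝ × ℝ → ℝ) p :=
  F.2.1.differentiable (by simp) p

lemma dirDeriv_add (U : ℝ × ℝ) (F G : tangentFun) :
    dirDeriv U (F + G) = dirDeriv U F + dirDeriv U G := by
  ext p
  have := fderiv_add (diffAt F p) (diffAt G p)
  simpa [dirDeriv] using congrArg (fun L => L U) this

lemma dirDeriv_sub (U : ℝ × ℝ) (F G : tangentFun) :
    dirDeriv U (F - G) = dirDeriv U F - dirDeriv U G := by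
  ext p
  have := fderiv_sub (diffAt F p) (diffAt G p)
  simpa [dirDeriv] using congrArg (fun L => L U) this

lemma dirDeriv_smul (U : ℝ × ℝ) (c : ℝ) (F : tangentFun) :
    dirDeriv U (c • F) = c • dirDeriv U F := by
  ext p
  have := fderiv_const_smul (diffAt F p) c
  simpa [dirDeriv] using congrArg (fun L => L U) this

lemma dirDeriv_mul (U : ℝ × ℝ) (F G : tangentFun) :
    dirDeriv U (F * G) = F * dirDeriv U G + G * dirDeriv U F := by
  ext p
  have := fderiv_mul (diffAt F p) (diffAt G p)
  simpa [dirDeriv] using congrArg (fun L => L U) this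

lemma dirDeriv_comm (U V : ℝ × ℝ) (F : tangentFun) :
    dirDeriv U (dirDeriv V F) = dirDeriv V (dirDeriv U F) := by
  ext p
  have hd : DifferentiableAt ℝ (fderiv ℝ (F : ℝ × ℝ → ℝ)) p :=
    (F.2.1.fderiv_right (m := ∞) (by simp)).differentiable (by simp) p
  have hs : IsSymmSndFDerivAt ℝ (F : ℝ × ℝ → ℝ) p :=
    F.2.1.contDiffAt.isSymmSndFDerivAt (by simp; exact WithTop.coe_le_coe.2 le_top)
  have key : ∀ A : ℝ × ℝ, fderiv ℝ (fun q => fderiv ℝ (F : ℝ × ℝ → ℝ) q A) p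
      = (fderiv ℝ (fderiv ℝ (F : ℝ × ℝ → ℝ)) p).flip A := fun A => by
    rw [fderiv_clm_apply hd (by fun_prop)]; simp
  show fderiv ℝ (fun q => fderiv ℝ (F : ℝ × ℝ → ℝ) q V) p U
    = fderiv ℝ (fun q => fderiv ℝ (F : ℝ × ℝ → ℝ) q U) p V
  rw [key, key]
  exact hs U V

lemma poisson_eq (γ : RiemannianCircle) (F G : tangentFun) :
    poisson γ F G = (poissonCoeff γ * (dirDeriv (0, 1) F * dirDeriv (1, 0) G
      - dirDeriv (1, 0) F * dirDeriv (0, 1) G) : tangentFun) := by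
  funext p
  simp [poisson, poissonCoeff, dirDeriv, dt, dy, div_eq_inv_mul]

/-- The Poisson bracket on `C^∞(Tγ)`. -/
def poissonBracket (γ : RiemannianCircle) (F G : tangentFun) : tangentFun :=
  ⟨poisson γ F G, by rw [poisson_eq]; exact Subtype.property _⟩

lemma poissonBracket_eq (γ : RiemannianCircle) (F G : tangentFun) :
    poissonBracket γ F G = poissonCoeff γ * (dirDeriv (0, 1) F * dirDeriv (1, 0) G
      - dirDeriv (1, 0) F * dirDeriv (0, 1) G) :=
  Subtype.ext (poisson_eq γ F G)

lemma poissonBracket_add_left (γ : RiemannianCircle) (F G K : tangentFun) :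
    poissonBracket γ (F + G) K = poissonBracket γ F K + poissonBracket γ G K := by
  simp only [poissonBracket_eq, dirDeriv_add]; ring

lemma poissonBracket_add_right (γ : RiemannianCircle) (F G K : tangentFun) :
    poissonBracket γ F (G + K) = poissonBracket γ F G + poissonBracket γ F K := by
  simp only [poissonBracket_eq, dirDeriv_add]; ring

lemma poissonBracket_self (γ : RiemannianCircle) (F : tangentFun) :
    poissonBracket γ F F = 0 := by
  rw [poissonBracket_eq]; ring

lemma poissonBracket_smul_right (γ : RiemannianCircle) (c : ℝ) (F G : tangentFun) :
    poissonBracket γ F (c • G) = c • poissonBracket γ F G := by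
  simp only [poissonBracket_eq, dirDeriv_smul, mul_smul_comm, ← smul_sub]

lemma poissonBracket_jacobi (γ : RiemannianCircle) (F G K : tangentFun) :
    poissonBracket γ F (poissonBracket γ G K) =
      poissonBracket γ (poissonBracket γ F G) K + poissonBracket γ G (poissonBracket γ F K) := by
  simp only [poissonBracket_eq, dirDeriv_mul, dirDeriv_sub]
  rw [dirDeriv_comm (1, 0) (0, 1) F, dirDeriv_comm (1, 0) (0, 1) G,
    dirDeriv_comm (1, 0) (0, 1) K]
  ring

/-- `C^∞(Tγ)` as a Lie algebra under the Poisson bracket of `Y_* ω`. -/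
def Observable (_γ : RiemannianCircle) : Type := tangentFun

instance (γ : RiemannianCircle) : AddCommGroup (Observable γ) :=
  inferInstanceAs (AddCommGroup tangentFun)

instance (γ : RiemannianCircle) : Module ℝ (Observable γ) :=
  inferInstanceAs (Module ℝ tangentFun)

instance (γ : RiemannianCircle) : LieRing (Observable γ) where
  bracket := poissonBracket γ
  add_lie := poissonBracket_add_left γ
  lie_add := poissonBracket_add_right γ
  lie_self := poissonBracket_self γ
  leibniz_lie := poissonBracket_jacobi γ

instance (γ : RiemannianCircle) : LieAlgebra ℝ (Observable γ) where
  lie_smul := poissonBracket_smul_right γ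

/-! ### The spaces of functions -/

lemma quotient_mem {A : ℝ × ℝ → ℝ} (hA : A ∈ tangentFun) :
    (fun p : ℝ × ℝ => A p / √(1 + p.2 ^ 2)) ∈ tangentFun :=
  ⟨hA.1.div (ContDiff.sqrt (by fun_prop) fun p => (one_add_sq_pos p.2).ne')
    fun p => (Real.sqrt_pos.2 (one_add_sq_pos p.2)).ne', fun t y => by simp [hA.2 t y]⟩

/-- The function `H_{d,h}(t, y) = h(t) y^d / √(1 + y²)` on `Tγ`. -/
def H (γ : RiemannianCircle) (d : ℕ) (h : circleFun) : Observable γ :=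
  ⟨fun p => (h : ℝ → ℝ) p.1 * p.2 ^ d / √(1 + p.2 ^ 2), quotient_mem
    ⟨(h.2.1.comp contDiff_fst).mul (contDiff_snd.pow d), fun t y => by simp [h.2.2 t]⟩⟩

lemma H_add (γ : RiemannianCircle) (d : ℕ) (h k : circleFun) :
    H γ d (h + k) = H γ d h + H γ d k := by
  refine Subtype.ext (funext fun p => ?_)
  change ((h : ℝ → ℝ) p.1 + (k : ℝ → ℝ) p.1) * p.2 ^ d / √(1 + p.2 ^ 2) =
    (h : ℝ → ℝ) p.1 * p.2 ^ d / √(1 + p.2 ^ 2) + (k : ℝ → ℝ) p.1 * p.2 ^ d / √(1 + p.2 ^ 2)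
  ring

lemma H_smul (γ : RiemannianCircle) (d : ℕ) (c : ℝ) (h : circleFun) :
    H γ d (c • h) = c • H γ d h := by
  refine Subtype.ext (funext fun p => ?_)
  change (c * (h : ℝ → ℝ) p.1) * p.2 ^ d / √(1 + p.2 ^ 2) =
    c * ((h : ℝ → ℝ) p.1 * p.2 ^ d / √(1 + p.2 ^ 2))
  ring

lemma H_zero (γ : RiemannianCircle) (d : ℕ) : H γ d 0 = 0 := by
  simpa using H_smul γ d 0 0

lemma arcIntegrable (γ : RiemannianCircle) (h : circleFun) :
    IntervalIntegrable (fun t => (h : ℝ → ℝ) t * γ.speed t) MeasureTheory.volume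
      0 (2 * Real.pi) :=
  (h.2.1.continuous.mul (speed_smooth γ).continuous).intervalIntegrable _ _

/-- `Λ_d = {H_{d,h} : h ∈ C^∞(γ)}`. -/
def Lam (γ : RiemannianCircle) (d : ℕ) : Submodule ℝ (Observable γ) where
  carrier := {F | ∃ h : circleFun, F = H γ d h}
  zero_mem' := ⟨0, (H_zero γ d).symm⟩
  add_mem' := by
    rintro _ _ ⟨h, rfl⟩ ⟨k, rfl⟩
    exact ⟨h + k, (H_add γ d h k).symm⟩
  smul_mem' := by
    rintro c _ ⟨h, rfl⟩
    exact ⟨c • h, (H_smul γ d c h).symm⟩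

/-- `Λ_{d,0} = {H_{d,h} : h ∈ C^∞(γ), ∫_γ h ds = 0}`. -/
def LamZero (γ : RiemannianCircle) (d : ℕ) : Submodule ℝ (Observable γ) where
  carrier := {F | ∃ h : circleFun, arcIntegral γ h = 0 ∧ F = H γ d h}
  zero_mem' := ⟨0, by simp [arcIntegral], (H_zero γ d).symm⟩
  add_mem' := by
    rintro _ _ ⟨h, h0, rfl⟩ ⟨k, k0, rfl⟩
    refine ⟨h + k, ?_, (H_add γ d h k).symm⟩
    have := intervalIntegral.integral_add (arcIntegrable γ h) (arcIntegrable γ k)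
    simp only [arcIntegral] at h0 k0 ⊢
    rw [h0, k0, add_zero] at this
    simpa [add_mul] using this
  smul_mem' := by
    rintro c _ ⟨h, h0, rfl⟩
    refine ⟨c • h, ?_, (H_smul γ d c h).symm⟩
    have := intervalIntegral.integral_const_mul (μ := MeasureTheory.volume)
      (a := 0) (b := 2 * Real.pi) c (fun t => (h : ℝ → ℝ) t * γ.speed t)
    simp only [arcIntegral] at h0 ⊢
    rw [h0, mul_zero] at this
    simpa [mul_assoc] using this

/-- For `Q(x) = ∑ a_j x^j`, the function `P(y) / √(1 + y²)` on `Tγ`, where `P(y) = y Q(y²)`,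
that is, `P(y) = ∑ a_j y^(2j+1)`. -/
def oddFun (γ : RiemannianCircle) (Q : Polynomial ℝ) : Observable γ :=
  ⟨fun p => p.2 * Q.eval (p.2 ^ 2) / √(1 + p.2 ^ 2), quotient_mem
    ⟨contDiff_snd.mul ((Polynomial.contDiff_aeval Q ∞).comp (contDiff_snd.pow 2)), fun _ _ => rfl⟩⟩

/-- `Ψ`: the functions `P(y) / √(1 + y²)` with `P(y) = ∑_{j ≥ 1} a_j y^(2j+1)` a polynomial such
that `Q(x) = ∑_{j ≥ 1} a_j x^j` satisfies `Q'(-1) = 0`. -/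
def Psi (γ : RiemannianCircle) : Submodule ℝ (Observable γ) where
  carrier := {F | ∃ Q : Polynomial ℝ, Q.coeff 0 = 0 ∧ Q.derivative.eval (-1) = 0 ∧
    F = oddFun γ Q}
  zero_mem' := ⟨0, by simp, by simp, Subtype.ext (funext fun p => by
    change (0 : ℝ) = p.2 * (0 : Polynomial ℝ).eval (p.2 ^ 2) / √(1 + p.2 ^ 2)
    simp)⟩
  add_mem' := by
    rintro _ _ ⟨Q, h0, h1, rfl⟩ ⟨R, k0, k1, rfl⟩
    refine ⟨Q + R, by simp [h0, k0], by simp [h1, k1], Subtype.ext (funext fun p => ?_)⟩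
    change p.2 * Q.eval (p.2 ^ 2) / √(1 + p.2 ^ 2) + p.2 * R.eval (p.2 ^ 2) / √(1 + p.2 ^ 2)
      = p.2 * (Q + R).eval (p.2 ^ 2) / √(1 + p.2 ^ 2)
    rw [Polynomial.eval_add]; ring
  smul_mem' := by
    rintro c _ ⟨Q, h0, h1, rfl⟩
    refine ⟨c • Q, by simp [h0], by simp [h1], Subtype.ext (funext fun p => ?_)⟩
    change c * (p.2 * Q.eval (p.2 ^ 2) / √(1 + p.2 ^ 2))
      = p.2 * (c • Q).eval (p.2 ^ 2) / √(1 + p.2 ^ 2)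
    rw [Polynomial.eval_smul, smul_eq_mul]; ring

/-- The Lie algebra generated, under the Poisson bracket, by the functions `H_{0,f}`,
`f ∈ C^∞(γ)`. -/
def generatedAlgebra (γ : RiemannianCircle) : LieSubalgebra ℝ (Observable γ) :=
  LieSubalgebra.lieSpan ℝ (Observable γ) (Set.range (H γ 0))

/-- The summands: `some d` gives `Λ_d` for `d = 1` or `d` even and `Λ_{d,0}` for odd `d ≥ 3`,
and `none` gives `Ψ`. -/
def summand (γ : RiemannianCircle) : Option ℕ → Submodule ℝ (Observable γ)
  | some d => if d = 1 ∨ Even d then Lam γ d else LamZero γ d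
  | none => Psi γ

end ThinFilm

end

open scoped ContDiff

noncomputable section

namespace ThinFilm

/-! ### Calculus on the circle -/

/-! Write `'` for the arc length derivative. Everything rests on `lie_H`: the bracket of `H_{d,h}`
and `H_{e,k}` is `H_{d+e-1, d h k' - e h' k} + H_{d+e+1, (d-1) h k' - (e-1) h' k}`. If `d + e` is
odd, both terms have even degree and meet no constraint. If `d + e = 2n + 2`, integration by parts
gives the two coefficients the integrals `(2n+2) I` and `2n I`, where `I = ∫ h k' ds`. This fixed
ratio is the condition `Q'(-1) = 0` for `Q = a x^n + b x^(n+1)`, so the sum of the summands is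
closed under the bracket (`lie_H_mem_iSup_summand`).

Conversely, brackets in degree 0 give `Λ_1`, and bracketing with `Λ_1` climbs through the even
degrees. Bracketing even degrees with `H_{0,1}` gives the odd functions of zero integral. One
bracket with `I ≠ 0` then couples each pair of adjacent odd degrees
(`H_add_H_mem_generatedAlgebra`), and the resulting binomials span `Ψ`.

The sum is direct because a function `∑ H_{d,h_d}` determines every `h_d` (`sumH_injective`), and a
constant of integral zero vanishes. -/

lemma circleFun_differentiable (h : circleFun) : Differentiable ℝ (h : ℝ → ℝ) :=
  h.2.1.differentiable (by simp)

lemma periodic_deriv {f : ℝ → ℝ} {T : ℝ} (hf : Function.Periodic f T) :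
    Function.Periodic (deriv f) T := fun t => by
  rw [← deriv_comp_add_const, show (fun x => f (x + T)) = f from funext hf]

/-- The density of the length element, as an element of `C^∞(γ)`. -/
def speedFun (γ : RiemannianCircle) : circleFun :=
  ⟨γ.speed, speed_smooth γ, fun t => by simp only [RiemannianCircle.speed, γ.periodic t]⟩

/-- The derivative `∂h/∂s` with respect to arc length. -/
def arcDeriv (γ : RiemannianCircle) (h : circleFun) : circleFun :=
  ⟨fun t => deriv h t / γ.speed t,
    (contDiff_infty_iff_deriv.1 h.2.1).2.div (speed_smooth γ) fun t => (speed_pos γ t).ne',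
    fun t => by
      simp only [periodic_deriv h.2.2 t, RiemannianCircle.speed, γ.periodic t]⟩

lemma arcDeriv_mul (γ : RiemannianCircle) (h k : circleFun) :
    arcDeriv γ (h * k) = arcDeriv γ h * k + h * arcDeriv γ k := by
  ext t
  change deriv ((h : ℝ → ℝ) * (k : ℝ → ℝ)) t / γ.speed t =
    deriv h t / γ.speed t * (k : ℝ → ℝ) t + (h : ℝ → ℝ) t * (deriv k t / γ.speed t)
  rw [deriv_mul (circleFun_differentiable h t) (circleFun_differentiable k t)]
  ring

lemma arcDeriv_one (γ : RiemannianCircle) : arcDeriv γ 1 = 0 := by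
  ext t
  change deriv (1 : ℝ → ℝ) t / γ.speed t = 0
  simp

/-- The integral over the circle as a linear functional on `C^∞(γ)`. -/
def arcIntegralLin (γ : RiemannianCircle) : circleFun →ₗ[ℝ] ℝ where
  toFun h := arcIntegral γ h
  map_add' h k := by
    have := intervalIntegral.integral_add (arcIntegrable γ h) (arcIntegrable γ k)
    simpa [arcIntegral, add_mul] using this
  map_smul' c h := by
    simp [arcIntegral, mul_assoc]

lemma arcIntegralLin_apply (γ : RiemannianCircle) (h : circleFun) :
    arcIntegralLin γ h = arcIntegral γ h := rfl

lemma arcIntegralLin_arcDeriv (γ : RiemannianCircle) (h : circleFun) :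
    arcIntegralLin γ (arcDeriv γ h) = 0 := by
  have h1 : arcIntegralLin γ (arcDeriv γ h) = ∫ t in (0 : ℝ)..(2 * Real.pi), deriv h t := by
    rw [arcIntegralLin_apply, arcIntegral]
    refine intervalIntegral.integral_congr fun t _ => ?_
    exact div_mul_cancel₀ _ (speed_pos γ t).ne'
  rw [h1, intervalIntegral.integral_deriv_eq_sub (fun t _ => circleFun_differentiable h t)
    ((contDiff_infty_iff_deriv.1 h.2.1).2.continuous.intervalIntegrable _ _)]
  simpa [sub_eq_zero] using h.2.2 0

/-- The primitive closes up after one turn exactly because the integral over a period is zero. -/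
lemma exists_arcDeriv_eq (γ : RiemannianCircle) {h : circleFun} (h0 : arcIntegralLin γ h = 0) :
    ∃ k, arcDeriv γ k = h := by
  have hs : ContDiff ℝ ∞ fun t => (h : ℝ → ℝ) t * γ.speed t := h.2.1.mul (speed_smooth γ)
  have hp : Function.Periodic (fun t => (h : ℝ → ℝ) t * γ.speed t) (2 * Real.pi) :=
    (h * speedFun γ).2.2
  have hd : ∀ t, HasDerivAt (fun t => ∫ x in (0 : ℝ)..t, (h : ℝ → ℝ) x * γ.speed x)
      ((h : ℝ → ℝ) t * γ.speed t) t := fun t =>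
    hs.continuous.integral_hasStrictDerivAt 0 t |>.hasDerivAt
  refine ⟨⟨fun t => ∫ x in (0 : ℝ)..t, (h : ℝ → ℝ) x * γ.speed x, ?_, fun t => ?_⟩, ?_⟩
  · rw [contDiff_infty_iff_deriv]
    exact ⟨fun t => (hd t).differentiableAt, by rwa [funext fun t => (hd t).deriv]⟩
  · have h1 := hp.intervalIntegral_add_eq t 0
    rw [zero_add] at h1
    have h2 : ∫ x in t..(t + 2 * Real.pi), (h : ℝ → ℝ) x * γ.speed x = 0 := h1.trans h0
    have h3 := intervalIntegral.integral_add_adjacent_intervals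
      (hs.continuous.intervalIntegrable (μ := MeasureTheory.volume) 0 t)
      (hs.continuous.intervalIntegrable t (t + 2 * Real.pi))
    rw [h2, add_zero] at h3
    exact h3.symm
  · ext t
    change deriv (fun t => ∫ x in (0 : ℝ)..t, (h : ℝ → ℝ) x * γ.speed x) t / γ.speed t = _
    rw [(hd t).deriv, mul_div_cancel_right₀ _ (speed_pos γ t).ne']

lemma arcIntegralLin_one_pos (γ : RiemannianCircle) : 0 < arcIntegralLin γ 1 := by
  refine intervalIntegral.intervalIntegral_pos_of_pos_on (arcIntegrable γ 1) (fun t _ => ?_)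
    Real.two_pi_pos
  change 0 < (1 : ℝ) * γ.speed t
  simpa using speed_pos γ t

/-- Every function is the sum of a constant and a function of integral zero. -/
lemma exists_const_add_arcDeriv (γ : RiemannianCircle) (h : circleFun) :
    ∃ (c : ℝ) (k : circleFun), h = c • 1 + arcDeriv γ k ∧
      arcIntegralLin γ h = c * arcIntegralLin γ 1 := by
  have hL := (arcIntegralLin_one_pos γ).ne'
  obtain ⟨k, hk⟩ := exists_arcDeriv_eq γ
    (h := h - (arcIntegralLin γ h / arcIntegralLin γ 1) • 1) (by simp [hL])
  exact ⟨arcIntegralLin γ h / arcIntegralLin γ 1, k, by rw [hk]; abel, by field_simp⟩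

/-- The function `sin` on the circle, in the coordinate `t`. -/
def sinFun : circleFun := ⟨Real.sin, Real.contDiff_sin, Real.sin_periodic⟩

/-- The function `cos` on the circle, in the coordinate `t`. -/
def cosFun : circleFun := ⟨Real.cos, Real.contDiff_cos, Real.cos_periodic⟩

lemma speedFun_mul_arcDeriv_sinFun (γ : RiemannianCircle) :
    speedFun γ * arcDeriv γ sinFun = cosFun := by
  ext t
  change γ.speed t * (deriv Real.sin t / γ.speed t) = Real.cos t
  rw [mul_div_cancel₀ _ (speed_pos γ t).ne', Real.deriv_sin]

lemma speedFun_mul_arcDeriv_cosFun (γ : RiemannianCircle) :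
    speedFun γ * arcDeriv γ cosFun = -sinFun := by
  ext t
  change γ.speed t * (deriv Real.cos t / γ.speed t) = -Real.sin t
  rw [mul_div_cancel₀ _ (speed_pos γ t).ne', Real.deriv_cos]

lemma cosFun_sq_add_sinFun_sq : cosFun * cosFun + sinFun * sinFun = 1 := by
  ext t
  change Real.cos t * Real.cos t + Real.sin t * Real.sin t = 1
  nlinarith [Real.cos_sq_add_sin_sq t]

/-- Every function is a sum of two products `h ∂k/∂s`, with `k = sin` and `k = cos`. -/
lemma eq_mul_arcDeriv_add (γ : RiemannianCircle) (f : circleFun) :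
    f * speedFun γ * cosFun * arcDeriv γ sinFun +
      (-(f * speedFun γ * sinFun)) * arcDeriv γ cosFun = f := by
  -- The speed turns `∂/∂s` into `∂/∂t`, so the sum is `f (cos² + sin²)`.
  linear_combination f * cosFun * speedFun_mul_arcDeriv_sinFun γ -
    f * sinFun * speedFun_mul_arcDeriv_cosFun γ + f * cosFun_sq_add_sinFun_sq

/-- Integration by parts: both integrals occurring in a bracket reduce to the single number `∫ h k'
ds`. -/
lemma arcIntegralLin_mul_arcDeriv (γ : RiemannianCircle) (h k : circleFun) :
    arcIntegralLin γ (arcDeriv γ h * k) = -arcIntegralLin γ (h * arcDeriv γ k) := by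
  have := arcIntegralLin_arcDeriv γ (h * k)
  rw [arcDeriv_mul, map_add] at this
  linarith

/-- The constant 1 is a sum of two such products, and its integral, the length of the circle, is
positive. -/
lemma exists_arcIntegralLin_mul_arcDeriv_ne_zero (γ : RiemannianCircle) :
    ∃ h k : circleFun, arcIntegralLin γ (h * arcDeriv γ k) ≠ 0 := by
  by_contra! H
  have h1 := eq_mul_arcDeriv_add γ 1
  have h2 := congrArg (arcIntegralLin γ) h1
  rw [map_add, H, H] at h2
  linarith [arcIntegralLin_one_pos γ]

/-! ### The bracket of two functions `H_{d,h}` -/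

lemma H_neg (γ : RiemannianCircle) (d : ℕ) (h : circleFun) : H γ d (-h) = -H γ d h := by
  simpa using H_smul γ d (-1) h

lemma H_sub (γ : RiemannianCircle) (d : ℕ) (h k : circleFun) :
    H γ d (h - k) = H γ d h - H γ d k := by
  rw [sub_eq_add_neg, H_add, H_neg, ← sub_eq_add_neg]

/-- The numerator is `d y^(d-1) (1 + y²) - y^(d+1)`. The cube is left explicit because it cancels
the one in `pushedForm_coeff`. -/
lemma hasDerivAt_pow_div_sqrt (d : ℕ) (y : ℝ) :
    HasDerivAt (fun y : ℝ => y ^ d / √(1 + y ^ 2))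
      ((d * y ^ (d - 1) + (d - 1) * y ^ (d + 1)) * (√(1 + y ^ 2) ^ 3)⁻¹) y := by
  have hp := one_add_sq_pos y
  have h0 : HasDerivAt (fun y : ℝ => 1 + y ^ 2) (2 * y) y := by
    simpa using (hasDerivAt_pow 2 y).const_add 1
  have hs : √(1 + y ^ 2) ≠ 0 := (Real.sqrt_pos.2 hp).ne'
  have h2 : √(1 + y ^ 2) ^ 2 = 1 + y ^ 2 := Real.sq_sqrt hp.le
  have h : HasDerivAt (fun y : ℝ => y ^ d / √(1 + y ^ 2)) _ y :=
    (hasDerivAt_pow d y).fun_div (h0.sqrt hp.ne') hs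
  refine h.congr_deriv ?_
  have h3 : (d : ℝ) * y ^ (d + 1) = d * y ^ (d - 1) * y ^ 2 := by
    cases d with
    | zero => simp
    | succ n => simp only [Nat.add_sub_cancel]; ring
  field_simp
  rw [h2]
  linear_combination -h3

lemma fderiv_H (d : ℕ) (h : circleFun) (p U : ℝ × ℝ) :
    fderiv ℝ (fun p : ℝ × ℝ => (h : ℝ → ℝ) p.1 * p.2 ^ d / √(1 + p.2 ^ 2)) p U =
      (h : ℝ → ℝ) p.1 * (((d * p.2 ^ (d - 1) + (d - 1) * p.2 ^ (d + 1)) *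
        (√(1 + p.2 ^ 2) ^ 3)⁻¹) * U.2) + p.2 ^ d / √(1 + p.2 ^ 2) * (deriv h p.1 * U.1) := by
  have h1 : HasFDerivAt (fun q : ℝ × ℝ => (h : ℝ → ℝ) q.1)
      (deriv (h : ℝ → ℝ) p.1 • ContinuousLinearMap.fst ℝ ℝ ℝ) p :=
    HasDerivAt.comp_hasFDerivAt p (circleFun_differentiable h p.1).hasDerivAt
      (hasFDerivAt_fst (𝕜 := ℝ) (E := ℝ) (F := ℝ) (p := p))
  have h0 : HasFDerivAt (fun q : ℝ × ℝ => q.2) (ContinuousLinearMap.snd ℝ ℝ ℝ) p :=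
    hasFDerivAt_snd
  have h2 : HasFDerivAt (fun q : ℝ × ℝ => q.2 ^ d / √(1 + q.2 ^ 2)) _ p :=
    (hasDerivAt_pow_div_sqrt d p.2).comp_hasFDerivAt p h0
  have h3 : (fun p : ℝ × ℝ => (h : ℝ → ℝ) p.1 * p.2 ^ d / √(1 + p.2 ^ 2)) =
      fun q => (h : ℝ → ℝ) q.1 * (q.2 ^ d / √(1 + q.2 ^ 2)) := by
    funext q; ring
  rw [h3, (h1.fun_mul h2).fderiv]
  simp

/-- The Poisson bracket of two functions `H_{d,h}`. -/
lemma lie_H (γ : RiemannianCircle) (d e : ℕ) (h k : circleFun) :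
    ⁅H γ d h, H γ e k⁆ =
      H γ (d + e - 1) ((d : ℝ) • (h * arcDeriv γ k) - (e : ℝ) • (arcDeriv γ h * k)) +
      H γ (d + e + 1)
        ((d - 1 : ℝ) • (h * arcDeriv γ k) - (e - 1 : ℝ) • (arcDeriv γ h * k)) := by
  refine Subtype.ext (funext fun p => ?_)
  have hu : √(1 + p.2 ^ 2) ≠ 0 := (Real.sqrt_pos.2 (one_add_sq_pos p.2)).ne'
  have hσ := (speed_pos γ p.1).ne'
  -- Natural subtraction truncates when `d = 0`, but the factor `d` kills that term. Likewise the
  -- exponent `d + e - 1` is truncated only for `d = e = 0`, where its coefficient is zero.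
  have hd : (d : ℝ) * (p.2 ^ (d - 1) * p.2 ^ e) = d * p.2 ^ (d + e - 1) := by
    cases d with
    | zero => simp
    | succ n => rw [← pow_add, show n + 1 - 1 + e = n + 1 + e - 1 by omega]
  have he : (e : ℝ) * (p.2 ^ (e - 1) * p.2 ^ d) = e * p.2 ^ (d + e - 1) := by
    cases e with
    | zero => simp
    | succ n => rw [← pow_add, show n + 1 - 1 + d = d + (n + 1) - 1 by omega]
  change (fderiv ℝ (fun p : ℝ × ℝ => (h : ℝ → ℝ) p.1 * p.2 ^ d / √(1 + p.2 ^ 2)) p (0, 1) *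
      fderiv ℝ (fun p : ℝ × ℝ => (k : ℝ → ℝ) p.1 * p.2 ^ e / √(1 + p.2 ^ 2)) p (1, 0) -
      fderiv ℝ (fun p : ℝ × ℝ => (h : ℝ → ℝ) p.1 * p.2 ^ d / √(1 + p.2 ^ 2)) p (1, 0) *
      fderiv ℝ (fun p : ℝ × ℝ => (k : ℝ → ℝ) p.1 * p.2 ^ e / √(1 + p.2 ^ 2)) p (0, 1)) /
      pushedForm γ p (0, 1) (1, 0) =
    ((d : ℝ) * ((h : ℝ → ℝ) p.1 * (deriv k p.1 / γ.speed p.1)) -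
      (e : ℝ) * (deriv h p.1 / γ.speed p.1 * (k : ℝ → ℝ) p.1)) * p.2 ^ (d + e - 1) /
        √(1 + p.2 ^ 2) +
    ((d - 1 : ℝ) * ((h : ℝ → ℝ) p.1 * (deriv k p.1 / γ.speed p.1)) -
      (e - 1 : ℝ) * (deriv h p.1 / γ.speed p.1 * (k : ℝ → ℝ) p.1)) * p.2 ^ (d + e + 1) /
        √(1 + p.2 ^ 2)
  rw [fderiv_H, fderiv_H, fderiv_H, fderiv_H, pushedForm_coeff]
  have hd' := congrArg (fun x => (h : ℝ → ℝ) p.1 * deriv k p.1 * x) hd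
  have he' := congrArg (fun x => (k : ℝ → ℝ) p.1 * deriv h p.1 * x) he
  field_simp
  linear_combination √(1 + p.2 ^ 2) ^ 2 * (hd' - he')

/-! ### The sum of the summands is a Lie subalgebra -/

lemma oddFun_add (γ : RiemannianCircle) (Q R : Polynomial ℝ) :
    oddFun γ (Q + R) = oddFun γ Q + oddFun γ R := by
  refine Subtype.ext (funext fun p => ?_)
  change p.2 * (Q + R).eval (p.2 ^ 2) / √(1 + p.2 ^ 2) =
    p.2 * Q.eval (p.2 ^ 2) / √(1 + p.2 ^ 2) + p.2 * R.eval (p.2 ^ 2) / √(1 + p.2 ^ 2)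
  rw [Polynomial.eval_add]; ring

lemma oddFun_smul (γ : RiemannianCircle) (c : ℝ) (Q : Polynomial ℝ) :
    oddFun γ (c • Q) = c • oddFun γ Q := by
  refine Subtype.ext (funext fun p => ?_)
  change p.2 * (c • Q).eval (p.2 ^ 2) / √(1 + p.2 ^ 2) =
    c * (p.2 * Q.eval (p.2 ^ 2) / √(1 + p.2 ^ 2))
  rw [Polynomial.eval_smul, smul_eq_mul]; ring

/-- `oddFun` as a linear map. -/
def oddFunLin (γ : RiemannianCircle) : Polynomial ℝ →ₗ[ℝ] Observable γ where
  toFun := oddFun γ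
  map_add' := oddFun_add γ
  map_smul' := oddFun_smul γ

lemma oddFun_monomial (γ : RiemannianCircle) (j : ℕ) (a : ℝ) :
    oddFun γ (Polynomial.monomial j a) = H γ (2 * j + 1) (a • 1) := by
  refine Subtype.ext (funext fun p => ?_)
  change p.2 * (Polynomial.monomial j a).eval (p.2 ^ 2) / √(1 + p.2 ^ 2) =
    a * 1 * p.2 ^ (2 * j + 1) / √(1 + p.2 ^ 2)
  rw [Polynomial.eval_monomial]; ring

lemma H_mem_iSup_summand (γ : RiemannianCircle) {d : ℕ} (hd : d = 1 ∨ Even d) (h : circleFun) :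
    H γ d h ∈ ⨆ i, summand γ i :=
  Submodule.mem_iSup_of_mem (some d) (by rw [summand, if_pos hd]; exact ⟨h, rfl⟩)

lemma H_mem_iSup_summand_of_integral (γ : RiemannianCircle) (d : ℕ) {h : circleFun}
    (h0 : arcIntegralLin γ h = 0) : H γ d h ∈ ⨆ i, summand γ i := by
  by_cases hd : d = 1 ∨ Even d
  · exact H_mem_iSup_summand γ hd h
  · exact Submodule.mem_iSup_of_mem (some d) (by rw [summand, if_neg hd]; exact ⟨h, h0, rfl⟩)

lemma oddFun_mem_iSup_summand (γ : RiemannianCircle) {Q : Polynomial ℝ} (h0 : Q.coeff 0 = 0)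
    (h1 : Q.derivative.eval (-1) = 0) : oddFun γ Q ∈ ⨆ i, summand γ i :=
  Submodule.mem_iSup_of_mem none ⟨Q, h0, h1, rfl⟩

/-- The binomials `a x^n + b x^(n+1)` with vanishing derivative at `-1`. -/
lemma eval_derivative_binomial (n : ℕ) {a b : ℝ} (hab : (n + 1) * b = n * a) :
    (Polynomial.monomial n a + Polynomial.monomial (n + 1) b).derivative.eval (-1) = 0 := by
  simp only [Polynomial.derivative_add, Polynomial.derivative_monomial, Polynomial.eval_add,
    Polynomial.eval_monomial]
  cases n with
  | zero =>
    have : b = 0 := by simpa using hab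
    simp [this]
  | succ n =>
    push_cast at hab ⊢
    simp only [pow_succ]
    linear_combination (-1) * (-1) ^ n * hab

/-- The components of degrees `2n+1` and `2n+3` of an element of the sum may be coupled through
their integrals. -/
lemma H_add_H_mem_iSup_summand (γ : RiemannianCircle) (n : ℕ) {h k : circleFun}
    (hhk : (n + 1) * arcIntegralLin γ k = n * arcIntegralLin γ h) :
    H γ (2 * n + 1) h + H γ (2 * n + 3) k ∈ ⨆ i, summand γ i := by
  cases n with
  | zero =>
    -- Degree 1 is unconstrained and excluded from `Ψ`; the hypothesis for `n = 0` says that `k` has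
    -- integral zero.
    refine Submodule.add_mem _ (H_mem_iSup_summand γ (Or.inl rfl) h)
      (H_mem_iSup_summand_of_integral γ _ ?_)
    simpa using hhk
  | succ n =>
    -- The constant parts form an element of `Ψ`; the exact parts have integral zero.
    obtain ⟨a, u, rfl, ha⟩ := exists_const_add_arcDeriv γ h
    obtain ⟨b, v, rfl, hb⟩ := exists_const_add_arcDeriv γ k
    have hab : ((n + 1 : ℕ) + 1 : ℝ) * b = (n + 1 : ℕ) * a := by
      rw [ha, hb] at hhk
      refine mul_right_cancel₀ (arcIntegralLin_one_pos γ).ne' ?_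
      linear_combination hhk
    have h1 := oddFun_mem_iSup_summand γ
      (Q := Polynomial.monomial (n + 1) a + Polynomial.monomial (n + 1 + 1) b)
      (by simp [Polynomial.coeff_monomial]) (eval_derivative_binomial (n + 1) hab)
    rw [oddFun_add, oddFun_monomial, oddFun_monomial] at h1
    rw [H_add, H_add, add_add_add_comm]
    exact Submodule.add_mem _ h1 (Submodule.add_mem _
      (H_mem_iSup_summand_of_integral γ _ (arcIntegralLin_arcDeriv γ u))
      (H_mem_iSup_summand_of_integral γ _ (arcIntegralLin_arcDeriv γ v)))

/-- For `d + e = 2(n + 1)` the two integrals are `d + e` and `d + e - 2` times `∫ h k' ds`, so they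
stand in the ratio `n + 1 : n`. -/
lemma lie_H_mem_iSup_summand (γ : RiemannianCircle) (d e : ℕ) (h k : circleFun) :
    ⁅H γ d h, H γ e k⁆ ∈ ⨆ i, summand γ i := by
  rw [lie_H]
  rcases Nat.even_or_odd' (d + e) with ⟨m, hm | hm⟩
  · cases m with
    | zero =>
      -- Here `d = e = 0`, and the truncated lower degree is 0.
      exact Submodule.add_mem _ (H_mem_iSup_summand γ (by right; simp [hm]) _)
        (H_mem_iSup_summand γ (by left; omega) _)
    | succ n =>
      rw [show d + e - 1 = 2 * n + 1 by omega, show d + e + 1 = 2 * n + 3 by omega]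
      apply H_add_H_mem_iSup_summand
      have hm' : (d : ℝ) + e = 2 * (n + 1) := by exact_mod_cast hm
      simp only [map_sub, map_smul, smul_eq_mul, arcIntegralLin_mul_arcDeriv]
      linear_combination arcIntegralLin γ (h * arcDeriv γ k) * hm'
  · exact Submodule.add_mem _
      (H_mem_iSup_summand γ (.inr ⟨m, by omega⟩) _) (H_mem_iSup_summand γ (.inr ⟨m + 1, by omega⟩) _)

/-- The span of all the functions `H_{d,h}`. -/
def spanH (γ : RiemannianCircle) : Submodule ℝ (Observable γ) :=
  Submodule.span ℝ (Set.range fun x : ℕ × circleFun => H γ x.1 x.2)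

lemma H_mem_spanH (γ : RiemannianCircle) (d : ℕ) (h : circleFun) : H γ d h ∈ spanH γ :=
  Submodule.subset_span ⟨(d, h), rfl⟩

lemma oddFun_eq_sum (γ : RiemannianCircle) (Q : Polynomial ℝ) :
    oddFun γ Q = ∑ j ∈ Q.support, H γ (2 * j + 1) (Q.coeff j • 1) := by
  simp only [← oddFun_monomial]
  conv_lhs => rw [Q.as_sum_support]
  exact map_sum (oddFunLin γ) _ _

lemma iSup_summand_le_spanH (γ : RiemannianCircle) : ⨆ i, summand γ i ≤ spanH γ := by
  refine iSup_le fun i => ?_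
  cases i with
  | none =>
    rintro _ ⟨Q, -, -, rfl⟩
    rw [oddFun_eq_sum]
    exact Submodule.sum_mem _ fun j _ => H_mem_spanH γ _ _
  | some d =>
    rw [summand]
    split_ifs
    · rintro _ ⟨h, rfl⟩
      exact H_mem_spanH γ d h
    · rintro _ ⟨h, -, rfl⟩
      exact H_mem_spanH γ d h

/-- The sum absorbs brackets of arbitrary `H_{d,h}`, with no condition on integrals. Closure thus
needs no separate treatment of each pair of summands. -/
lemma lie_mem_iSup_summand (γ : RiemannianCircle) {x y : Observable γ} (hx : x ∈ spanH γ)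
    (hy : y ∈ spanH γ) : ⁅x, y⁆ ∈ ⨆ i, summand γ i := by
  induction hx using Submodule.span_induction with
  | zero => rw [zero_lie]; exact Submodule.zero_mem _
  | add a b _ _ ha hb => rw [add_lie]; exact Submodule.add_mem _ ha hb
  | smul c a _ ha => rw [smul_lie]; exact Submodule.smul_mem _ c ha
  | mem a ha =>
    obtain ⟨⟨d, h⟩, rfl⟩ := ha
    induction hy using Submodule.span_induction with
    | zero => rw [lie_zero]; exact Submodule.zero_mem _
    | add a b _ _ ha hb => rw [lie_add]; exact Submodule.add_mem _ ha hb
    | smul c a _ ha => rw [lie_smul]; exact Submodule.smul_mem _ c ha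
    | mem b hb =>
      obtain ⟨⟨e, k⟩, rfl⟩ := hb
      exact lie_H_mem_iSup_summand γ d e h k

/-- The sum of the summands, as a Lie subalgebra. -/
def sumSubalgebra (γ : RiemannianCircle) : LieSubalgebra ℝ (Observable γ) where
  __ := ⨆ i, summand γ i
  lie_mem' hx hy :=
    lie_mem_iSup_summand γ (iSup_summand_le_spanH γ hx) (iSup_summand_le_spanH γ hy)

lemma generatedAlgebra_le_iSup_summand (γ : RiemannianCircle) :
    (generatedAlgebra γ).toSubmodule ≤ ⨆ i, summand γ i := by
  have h : generatedAlgebra γ ≤ sumSubalgebra γ := by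
    rw [generatedAlgebra, LieSubalgebra.lieSpan_le]
    rintro _ ⟨f, rfl⟩
    exact H_mem_iSup_summand γ (.inr (by simp)) f
  exact h

/-! ### The summands lie in the generated algebra -/

lemma H_zero_mem_generatedAlgebra (γ : RiemannianCircle) (f : circleFun) :
    H γ 0 f ∈ generatedAlgebra γ := LieSubalgebra.subset_lieSpan ⟨f, rfl⟩

/-- Brackets in degree 0 yield the coefficients `h' k - h k'`. Taking `k = 1` gives all functions of
integral zero, a space of codimension one, so a single bracket with nonzero integral supplies the
rest. -/
lemma H_one_mem_generatedAlgebra (γ : RiemannianCircle) (f : circleFun) :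
    H γ 1 f ∈ generatedAlgebra γ := by
  have key : ∀ h k, H γ 1 (arcDeriv γ h * k - h * arcDeriv γ k) ∈ generatedAlgebra γ := by
    intro h k
    have h1 := (generatedAlgebra γ).lie_mem (H_zero_mem_generatedAlgebra γ h)
      (H_zero_mem_generatedAlgebra γ k)
    rw [lie_H] at h1
    simp only [Nat.cast_zero, zero_smul, sub_zero, H_zero, zero_sub, neg_smul, one_smul, zero_add,
      sub_neg_eq_add] at h1
    rwa [sub_eq_neg_add]
  have hderiv : ∀ u, H γ 1 (arcDeriv γ u) ∈ generatedAlgebra γ := fun u => by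
    simpa [arcDeriv_one] using key u 1
  obtain ⟨h, k, hhk⟩ := exists_arcIntegralLin_mul_arcDeriv_ne_zero γ
  set g := arcDeriv γ h * k - h * arcDeriv γ k with hg
  have hg0 : arcIntegralLin γ g ≠ 0 := by
    rw [hg, map_sub, arcIntegralLin_mul_arcDeriv]
    contrapose! hhk
    linarith
  obtain ⟨u, hu⟩ := exists_arcDeriv_eq γ
    (h := f - (arcIntegralLin γ f / arcIntegralLin γ g) • g) (by simp [hg0])
  rw [eq_add_of_sub_eq hu.symm, H_add, H_smul]
  exact (generatedAlgebra γ).add_mem (hderiv u) ((generatedAlgebra γ).smul_mem _ (key h k))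

lemma H_even_mem_generatedAlgebra (γ : RiemannianCircle) (m : ℕ) (f : circleFun) :
    H γ (2 * m) f ∈ generatedAlgebra γ := by
  induction m generalizing f with
  | zero => exact H_zero_mem_generatedAlgebra γ f
  | succ m ih =>
    have key : ∀ h k, H γ (2 * (m + 1)) (h * arcDeriv γ k) ∈ generatedAlgebra γ := by
      intro h k
      have h1 := (generatedAlgebra γ).lie_mem (ih h) (H_one_mem_generatedAlgebra γ k)
      rw [lie_H, Nat.add_sub_cancel] at h1
      -- The lower term has degree `2m` and is already available. In the upper one `e - 1 = 0`
      -- removes `h' k`, leaving `(2m - 1) h k'`, whose factor is odd and hence nonzero.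
      have h2 := (generatedAlgebra γ).sub_mem h1
        (ih (((2 * m : ℕ) : ℝ) • (h * arcDeriv γ k) - ((1 : ℕ) : ℝ) • (arcDeriv γ h * k)))
      rw [add_sub_cancel_left, Nat.cast_one, sub_self, zero_smul, sub_zero, H_smul] at h2
      have hm : ((2 * m : ℕ) - 1 : ℝ) ≠ 0 := by
        rw [sub_ne_zero]
        exact_mod_cast (by omega : 2 * m ≠ 1)
      have h3 := (generatedAlgebra γ).smul_mem ((2 * m : ℕ) - 1 : ℝ)⁻¹ h2
      rwa [inv_smul_smul₀ hm] at h3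
    rw [← eq_mul_arcDeriv_add γ f, H_add]
    exact (generatedAlgebra γ).add_mem (key _ _) (key _ _)

/-- Bracketing with `H_{0,1}` differentiates the coefficient: since `1' = 0`, only the upper term
survives. -/
lemma H_arcDeriv_mem_generatedAlgebra (γ : RiemannianCircle) (m : ℕ) (u : circleFun) :
    H γ (2 * m + 1) (arcDeriv γ u) ∈ generatedAlgebra γ := by
  have h1 := (generatedAlgebra γ).lie_mem (H_even_mem_generatedAlgebra γ m u)
    (H_zero_mem_generatedAlgebra γ 1)
  simpa [lie_H, arcDeriv_one, H_zero] using h1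

lemma H_odd_mem_generatedAlgebra (γ : RiemannianCircle) (m : ℕ) {f : circleFun}
    (hf : arcIntegralLin γ f = 0) : H γ (2 * m + 1) f ∈ generatedAlgebra γ := by
  obtain ⟨u, rfl⟩ := exists_arcDeriv_eq γ hf
  exact H_arcDeriv_mem_generatedAlgebra γ m u

/-- Modulo functions of integral zero, which are already available, only the two integrals matter.
The hypothesis puts them on a line spanned by those of a single bracket. -/
lemma H_add_H_mem_generatedAlgebra (γ : RiemannianCircle) (n : ℕ) {p q : circleFun}
    (hpq : (n + 1) * arcIntegralLin γ q = n * arcIntegralLin γ p) :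
    H γ (2 * n + 1) p + H γ (2 * n + 3) q ∈ generatedAlgebra γ := by
  obtain ⟨h, k, hhk⟩ := exists_arcIntegralLin_mul_arcDeriv_ne_zero γ
  have h1 := (generatedAlgebra γ).lie_mem (H_even_mem_generatedAlgebra γ (n + 1) h)
    (H_zero_mem_generatedAlgebra γ k)
  rw [lie_H, show 2 * (n + 1) + 0 - 1 = 2 * n + 1 by omega,
    show 2 * (n + 1) + 0 + 1 = 2 * n + 3 by omega] at h1
  set c := arcIntegralLin γ (h * arcDeriv γ k) with hc
  have hn : (n + 1 : ℝ) ≠ 0 := by positivity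
  -- The bracket coefficients `p₀` and `q₀` have integrals `2(n+1)c` and `2nc`; `r` matches the
  -- first with that of `p`, and `hpq` then matches the second.
  set r := arcIntegralLin γ p / (2 * (n + 1) * c) with hr
  have hrc : r * (2 * (n + 1) * c) = arcIntegralLin γ p := by
    rw [hr]; field_simp
  set p₀ := ((2 * (n + 1) : ℕ) : ℝ) • (h * arcDeriv γ k) - ((0 : ℕ) : ℝ) • (arcDeriv γ h * k)
    with hp₀
  set q₀ := (((2 * (n + 1) : ℕ) : ℝ) - 1) • (h * arcDeriv γ k) -
    (((0 : ℕ) : ℝ) - 1) • (arcDeriv γ h * k) with hq₀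
  have hp : arcIntegralLin γ (p - r • p₀) = 0 := by
    simp only [hp₀, map_sub, map_smul, smul_eq_mul, arcIntegralLin_mul_arcDeriv, ← hc]
    push_cast
    linear_combination -hrc
  have hq : arcIntegralLin γ (q - r • q₀) = 0 := by
    simp only [hq₀, map_sub, map_smul, smul_eq_mul, arcIntegralLin_mul_arcDeriv, ← hc]
    refine mul_left_cancel₀ hn ?_
    push_cast
    linear_combination hpq - n * hrc
  have h2 := (generatedAlgebra γ).add_mem ((generatedAlgebra γ).smul_mem r h1)
    ((generatedAlgebra γ).add_mem (H_odd_mem_generatedAlgebra γ n hp)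
      (H_odd_mem_generatedAlgebra γ (n + 1) hq))
  rw [show 2 * (n + 1) + 1 = 2 * n + 3 by omega, H_sub γ _ p,
    H_sub γ _ q, H_smul γ _ r, H_smul γ _ r, smul_add] at h2
  convert h2 using 1
  abel

/-- Induction on the degree: subtracting a binomial `a x^(n+1) + b x^(n+2)` with vanishing
derivative at -1 removes the leading term and preserves both conditions. In degree at most 1 only `Q
= 0` satisfies them. -/
lemma oddFun_mem_generatedAlgebra (γ : RiemannianCircle) {Q : Polynomial ℝ} (h0 : Q.coeff 0 = 0)
    (h1 : Q.derivative.eval (-1) = 0) : oddFun γ Q ∈ generatedAlgebra γ := by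
  suffices H : ∀ (n : ℕ) (Q : Polynomial ℝ), Q.natDegree ≤ n + 1 → Q.coeff 0 = 0 →
      Q.derivative.eval (-1) = 0 → oddFun γ Q ∈ generatedAlgebra γ from
    H Q.natDegree Q (Nat.le_succ _) h0 h1
  clear h0 h1 Q
  intro n
  induction n with
  | zero =>
    intro Q hQ h0 h1
    obtain ⟨a, b, rfl⟩ := Polynomial.exists_eq_X_add_C_of_natDegree_le_one hQ
    simp only [Polynomial.coeff_add, Polynomial.mul_coeff_zero, Polynomial.coeff_C_zero,
      Polynomial.coeff_X_zero, mul_zero, zero_add] at h0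
    have ha : a = 0 := by simpa using h1
    have hz : oddFun γ 0 = 0 := map_zero (oddFunLin γ)
    simp [h0, ha, hz]
  | succ n ih =>
    intro Q hQ h0 h1
    set b := Q.coeff (n + 2) with hb
    have hn : ((n + 1 : ℕ) : ℝ) ≠ 0 := by positivity
    set a : ℝ := (((n + 1 : ℕ) : ℝ) + 1) * b / (n + 1 : ℕ) with ha
    have hab : (((n + 1 : ℕ) : ℝ) + 1) * b = (n + 1 : ℕ) * a := by
      rw [ha]; field_simp
    set R := Polynomial.monomial (n + 1) a + Polynomial.monomial (n + 1 + 1) b with hR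
    have hRmem : oddFun γ R ∈ generatedAlgebra γ := by
      rw [hR, oddFun_add, oddFun_monomial, oddFun_monomial]
      refine H_add_H_mem_generatedAlgebra γ (n + 1) ?_
      simp only [map_smul, smul_eq_mul]
      linear_combination arcIntegralLin γ 1 * hab
    have hsub : oddFun γ (Q - R) ∈ generatedAlgebra γ := by
      refine ih _ ?_ ?_ ?_
      · rw [Polynomial.natDegree_le_iff_coeff_eq_zero]
        intro N hN
        rcases eq_or_lt_of_le (Nat.succ_le_of_lt hN) with h | h
        · subst h
          simp [hR, Polynomial.coeff_monomial, hb]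
        · rw [Polynomial.coeff_sub, Polynomial.coeff_eq_zero_of_natDegree_lt (by omega), hR,
            Polynomial.coeff_add, Polynomial.coeff_monomial, Polynomial.coeff_monomial,
            if_neg (by omega), if_neg (by omega)]
          simp
      · simp [hR, h0, Polynomial.coeff_monomial]
      · rw [Polynomial.derivative_sub, Polynomial.eval_sub, h1, hR,
          eval_derivative_binomial _ hab, sub_zero]
    have h2 := (generatedAlgebra γ).add_mem hsub hRmem
    rwa [← oddFun_add, sub_add_cancel] at h2

lemma iSup_summand_le_generatedAlgebra (γ : RiemannianCircle) :
    ⨆ i, summand γ i ≤ (generatedAlgebra γ).toSubmodule := by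
  refine iSup_le fun i => ?_
  cases i with
  | none =>
    rintro _ ⟨Q, h0, h1, rfl⟩
    exact oddFun_mem_generatedAlgebra γ h0 h1
  | some d =>
    rw [summand]
    split_ifs with hd
    · rintro _ ⟨h, rfl⟩
      rcases hd with rfl | hd
      · exact H_one_mem_generatedAlgebra γ h
      · obtain ⟨m, rfl⟩ := hd.two_dvd
        exact H_even_mem_generatedAlgebra γ m h
    · rintro _ ⟨h, h0, rfl⟩
      obtain ⟨m, rfl⟩ := Nat.not_even_iff_odd.1 fun h => hd (.inr h)
      exact H_odd_mem_generatedAlgebra γ m h0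

/-! ### Independence of the summands -/

/-- The map sending a finite family `(h_d)` to `∑ H_{d,h_d}`. -/
def sumH (γ : RiemannianCircle) : (ℕ →₀ circleFun) →ₗ[ℝ] Observable γ :=
  Finsupp.lsum ℝ fun d =>
    { toFun := H γ d, map_add' := H_add γ d, map_smul' := H_smul γ d }

lemma sumH_single (γ : RiemannianCircle) (d : ℕ) (h : circleFun) :
    sumH γ (Finsupp.single d h) = H γ d h := by
  exact Finsupp.sum_single_index (H_zero γ d)

/-- The evaluation at a point, as a linear map. -/
def evalLin (γ : RiemannianCircle) (p : ℝ × ℝ) : Observable γ →ₗ[ℝ] ℝ where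
  toFun F := F.1 p
  map_add' _ _ := rfl
  map_smul' _ _ := rfl

/-- At fixed `t`, clearing the square root leaves a polynomial in `y` that vanishes identically. -/
lemma sumH_injective (γ : RiemannianCircle) : Function.Injective (sumH γ) := by
  suffices H : ∀ x, sumH γ x = 0 → x = 0 from fun x y hxy =>
    sub_eq_zero.1 (H (x - y) (((sumH γ).map_sub x y).trans (sub_eq_zero.2 hxy)))
  intro x hx
  have hpoly : ∀ t, ∑ d ∈ x.support, Polynomial.monomial d ((x d : ℝ → ℝ) t) = 0 := by
    refine fun t => Polynomial.funext fun y => ?_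
    have h1 : evalLin γ (t, y) (sumH γ x) = 0 := by rw [hx, map_zero]
    rw [sumH, Finsupp.lsum_apply, Finsupp.sum, map_sum] at h1
    change ∑ d ∈ x.support, (x d : ℝ → ℝ) t * y ^ d / √(1 + y ^ 2) = 0 at h1
    rw [← Finset.sum_div, div_eq_zero_iff] at h1
    simp only [Polynomial.eval_finsetSum, Polynomial.eval_monomial, Polynomial.eval_zero]
    exact h1.resolve_right (Real.sqrt_pos.2 (one_add_sq_pos y)).ne'
  ext d t
  have h2 := congrArg (Polynomial.coeff · d) (hpoly t)
  simp only [Polynomial.finsetSum_coeff, Polynomial.coeff_monomial, Finset.sum_ite_eq',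
    Polynomial.coeff_zero] at h2
  split_ifs at h2 with hd
  · exact h2
  · rw [Finsupp.notMem_support_iff.1 hd]; rfl

/-- The coefficient families of the elements of the summands (without the condition on the
polynomial in `Ψ`). -/
def coeffSpace (γ : RiemannianCircle) : Option ℕ → Submodule ℝ (ℕ →₀ circleFun)
  | some d => (if d = 1 ∨ Even d then ⊤ else LinearMap.ker (arcIntegralLin γ)).map
      (Finsupp.lsingle d)
  | none => ⨅ d, (if d = 1 ∨ Even d then ⊥ else Submodule.span ℝ {1}).comap (Finsupp.lapply d)

lemma apply_eq_zero_of_mem_coeffSpace_none (γ : RiemannianCircle) {x : ℕ →₀ circleFun}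
    (hx : x ∈ coeffSpace γ none) {d : ℕ} (hd : d = 1 ∨ Even d) : x d = 0 := by
  have h := (Submodule.mem_iInf _).1 hx d
  rw [if_pos hd] at h
  simpa using h

lemma apply_mem_of_mem_coeffSpace_none (γ : RiemannianCircle) {x : ℕ →₀ circleFun}
    (hx : x ∈ coeffSpace γ none) (d : ℕ) : ∃ c : ℝ, c • 1 = x d := by
  have h := (Submodule.mem_iInf _).1 hx d
  by_cases hd : d = 1 ∨ Even d
  · exact ⟨0, by rw [apply_eq_zero_of_mem_coeffSpace_none γ hx hd, zero_smul]⟩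
  · rw [if_neg hd] at h
    exact Submodule.mem_span_singleton.1 h

lemma arcIntegralLin_apply_of_mem_coeffSpace_some (γ : RiemannianCircle) {x : ℕ →₀ circleFun}
    {e : ℕ} (hx : x ∈ coeffSpace γ (some e)) {d : ℕ} (hd : ¬(d = 1 ∨ Even d)) :
    arcIntegralLin γ (x d) = 0 := by
  obtain ⟨h, hh, rfl⟩ := hx
  rw [Finsupp.lsingle_apply, Finsupp.single_apply]
  split_ifs with he
  · subst he
    simpa [hd] using hh
  · exact map_zero _

/-- In each odd degree at least 3, the other spaces contribute only functions of integral zero,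
while this one contributes constants. -/
lemma disjoint_coeffSpace_none (γ : RiemannianCircle) :
    Disjoint (coeffSpace γ none) (⨆ (j) (_ : j ≠ none), coeffSpace γ j) := by
  let K : Submodule ℝ (ℕ →₀ circleFun) := ⨅ (d : ℕ) (_ : ¬(d = 1 ∨ Even d)),
    (LinearMap.ker (arcIntegralLin γ)).comap (Finsupp.lapply d)
  have hK : ∀ x ∈ K, ∀ d, ¬(d = 1 ∨ Even d) → arcIntegralLin γ (x d) = 0 := fun x hx d hd =>
    (Submodule.mem_iInf _).1 ((Submodule.mem_iInf _).1 hx d) hd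
  have hle : (⨆ (j) (_ : j ≠ none), coeffSpace γ j) ≤ K := by
    refine iSup₂_le fun j hj => ?_
    cases j with
    | none => exact absurd rfl hj
    | some e =>
      exact le_iInf₂ fun d hd x hx => arcIntegralLin_apply_of_mem_coeffSpace_some γ hx hd
  refine Submodule.disjoint_def.2 fun x hx hx' => ?_
  ext1 d
  by_cases hd : d = 1 ∨ Even d
  · exact apply_eq_zero_of_mem_coeffSpace_none γ hx hd
  · have h1 := hK x (hle hx') d hd
    obtain ⟨c, hc⟩ := apply_mem_of_mem_coeffSpace_none γ hx d
    rw [← hc, map_smul, smul_eq_mul, mul_eq_zero] at h1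
    rw [← hc, h1.resolve_right (arcIntegralLin_one_pos γ).ne', zero_smul]
    rfl

lemma disjoint_coeffSpace_some (γ : RiemannianCircle) (d : ℕ) :
    Disjoint (coeffSpace γ (some d)) (⨆ (j) (_ : j ≠ some d), coeffSpace γ j) := by
  have hle : (⨆ (j) (_ : j ≠ some d), coeffSpace γ j) ≤
      (if d = 1 ∨ Even d then ⊥ else Submodule.span ℝ {1}).comap (Finsupp.lapply d) := by
    refine iSup₂_le fun j hj => ?_
    cases j with
    | none => exact iInf_le _ d
    | some e =>
      rintro _ ⟨h, -, rfl⟩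
      have hde : e ≠ d := fun h => hj (by rw [h])
      rw [Submodule.mem_comap, Finsupp.lsingle_apply, Finsupp.lapply_apply,
        Finsupp.single_eq_of_ne hde.symm]
      exact Submodule.zero_mem _
  refine Submodule.disjoint_def.2 fun x hx hx' => ?_
  obtain ⟨h, hh, rfl⟩ := hx
  have hx := hle hx'
  rw [Submodule.mem_comap, Finsupp.lsingle_apply, Finsupp.lapply_apply,
    Finsupp.single_eq_same] at hx
  suffices h = 0 by rw [this, map_zero]
  by_cases hd : d = 1 ∨ Even d
  · rw [if_pos hd] at hx
    exact hx
  · rw [if_neg hd] at hx hh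
    obtain ⟨c, rfl⟩ := Submodule.mem_span_singleton.1 hx
    have h1 : arcIntegralLin γ (c • 1) = 0 := hh
    rw [map_smul, smul_eq_mul, mul_eq_zero] at h1
    rw [h1.resolve_right (arcIntegralLin_one_pos γ).ne', zero_smul]

lemma iSupIndep_coeffSpace (γ : RiemannianCircle) : iSupIndep (coeffSpace γ)
  | none => disjoint_coeffSpace_none γ
  | some d => disjoint_coeffSpace_some γ d

lemma summand_le_map_coeffSpace (γ : RiemannianCircle) (i : Option ℕ) :
    summand γ i ≤ (coeffSpace γ i).map (sumH γ) := by
  cases i with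
  | none =>
    rintro _ ⟨Q, h0, -, rfl⟩
    rw [oddFun_eq_sum]
    refine Submodule.sum_mem _ fun j hj => ?_
    refine ⟨Finsupp.single (2 * j + 1) (Q.coeff j • 1), ?_, sumH_single γ _ _⟩
    -- The vanishing constant term of `Q` keeps degree 1 out of `Ψ`, so only odd degrees at least 3
    -- occur.
    have hj0 : j ≠ 0 := by rintro rfl; exact Polynomial.mem_support_iff.1 hj h0
    refine Submodule.mem_iInf _ |>.2 fun d => ?_
    rw [Submodule.mem_comap, Finsupp.lapply_apply, Finsupp.single_apply]
    split_ifs with h1 h2 h2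
    · subst h2
      rcases h1 with h1 | ⟨r, hr⟩ <;> omega
    · exact Submodule.zero_mem _
    · exact Submodule.smul_mem _ _ (Submodule.mem_span_singleton_self _)
    · exact Submodule.zero_mem _
  | some d =>
    rw [summand, coeffSpace]
    split_ifs
    · rintro _ ⟨h, rfl⟩
      exact ⟨_, ⟨h, trivial, rfl⟩, sumH_single γ d h⟩
    · rintro _ ⟨h, h0, rfl⟩
      exact ⟨_, ⟨h, h0, rfl⟩, sumH_single γ d h⟩

end ThinFilm

end

theorem theorem1p12 (γ : ThinFilm.RiemannianCircle) :
    iSupIndep (ThinFilm.summand γ) ∧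
      (ThinFilm.generatedAlgebra γ).toSubmodule = ⨆ i, ThinFilm.summand γ i :=
  -- Independence passes through an injective linear map and then to smaller subspaces, so the
  -- condition `Q'(-1) = 0` plays no role in it.
  ⟨((ThinFilm.sumH γ).iSupIndep_map (ThinFilm.sumH_injective γ)
      (ThinFilm.iSupIndep_coeffSpace γ)).mono (ThinFilm.summand_le_map_coeffSpace γ),
    le_antisymm (ThinFilm.generatedAlgebra_le_iSup_summand γ)
      (ThinFilm.iSup_summand_le_generatedAlgebra γ)⟩
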